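/- Let $n\ge 1$ and let $\mathfrak S_n$ be the set of permutations $\sigma=\sigma_1\cdots\sigma_n$ of $\{1,\dots,n\}$. Let $\operatorname{des}\sigma$ be the number of $i<n$ with $\sigma_i>\sigma_{i+1}$, let $(2\text{-}13)\sigma$ be the number of pairs $1\le i<j\le n-1$ with $\sigma_{j+1}>\sigma_i>\sigma_j$, and let $(31\text{-}2)\sigma$ be the number of pairs $2\le i<j\le n$ with $\sigma_{i-1}>\sigma_j>\sigma_i$. In a word $w_1\cdots w_m$ of distinct positive integers put $w_0=w_{m+1}=0$; for $1\le i\le m$ the letter $w_i$ is a valley if $w_{i-1}>w_i<w_{i+1}$ and a double descent if $w_{i-1}>w_i>w_{i+1}$. A permutation $\sigma\in\mathfrak S_n$ is an André permutation if, for every $1\le k\le n$, the subword of $\sigma$ consisting of the letters $1,\dots,k$ has no double descent. Let $\mathcal G_{n,k}$ be the set of $\sigma\in\mathfrak S_n$ with exactly $k$ valleys and no double descent, and let $\mathfrak D_{n,k}$ be the set of André permutations in $\mathfrak S_n$ with exactly $k$ descents. Define $$A_n(p,q,t)=\sum_{\sigma\in\mathfrak S_n}p^{(2\text{-}13)\sigma}q^{(31\text{-}2)\sigma}t^{\operatorname{des}\sigma},\qquad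 \gamma_{n,k}(p,q)=\sum_{\sigma\in\mathcal G_{n,k}}p^{(2\text{-}13)\sigma}q^{(31\text{-}2)\sigma},\qquad d_{n,k}(p,q)=\sum_{\sigma\in\mathfrak D_{n,k}}p^{(2\text{-}13)\sigma}q^{(31\text{-}2)\sigma-k}.$$ Then $(31\text{-}2)\sigma\ge k$ for every $\sigma\in\mathfrak D_{n,k}$, so that $d_{n,k}(p,q)$ is a polynomial with nonnegative integer coefficients, and $$A_n(p,q,t)=\sum_{k=0}^{\lfloor (n-1)/2\rfloor}\gamma_{n,k}(p,q)\,t^k(1+t)^{n-1-2k}=\sum_{k=0}^{\lfloor (n-1)/2\rfloor}(p+q)^k\,d_{n,k}(p,q)\,t^k(1+t)^{n-1-2k}.$$ Moreover $\gamma_{n,k}(p,q)=(p+q)^k\,d_{n,k}(p,q)$ for all $0\le k\le\lfloor (n-1)/2\rfloor$. These identities hold in $\mathbb N[p,q,t]$, equivalently for all elements $p,q,t$ of any commutative semiring. -/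

import Mathlib

namespace PQEulerian

/-- The one-line word `σ₁ σ₂ … σₙ` of a permutation, with letters in `{1, …, n}`. -/
def word {n : ℕ} (σ : Equiv.Perm (Fin n)) : List ℕ :=
  List.ofFn fun i : Fin n => (σ i : ℕ) + 1

/-- The entry `wᵢ` of a word of length `n`, indexed from `1`, with the boundary convention
`w₀ = wₙ₊₁ = 0`. -/
def entry (w : List ℕ) (i : ℕ) : ℕ := (0 :: w).getD i 0

/-- The number of descents, i.e. of positions `1 ≤ i < n` with `wᵢ > wᵢ₊₁`. -/
def des (w : List ℕ) : ℕ :=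
  ((Finset.Ico 1 w.length).filter fun i => entry w i > entry w (i + 1)).card

/-- The number of valleys `wᵢ₋₁ > wᵢ < wᵢ₊₁`, `1 ≤ i ≤ n`, where `w₀ = wₙ₊₁ = 0`. -/
def valley (w : List ℕ) : ℕ :=
  ((Finset.Icc 1 w.length).filter fun i =>
    entry w (i - 1) > entry w i ∧ entry w i < entry w (i + 1)).card

/-- The number of double descents `wᵢ₋₁ > wᵢ > wᵢ₊₁`, `1 ≤ i ≤ n`, where `w₀ = wₙ₊₁ = 0`. -/
def dd (w : List ℕ) : ℕ :=
  ((Finset.Icc 1 w.length).filter fun i =>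
    entry w (i - 1) > entry w i ∧ entry w i > entry w (i + 1)).card

/-- The statistic `(31-2)`: the number of pairs `2 ≤ i < j ≤ n` with `wᵢ₋₁ > wⱼ > wᵢ`. -/
def les (w : List ℕ) : ℕ :=
  ((Finset.Icc 2 w.length ×ˢ Finset.Icc 2 w.length).filter fun x =>
    x.1 < x.2 ∧ entry w (x.1 - 1) > entry w x.2 ∧ entry w x.2 > entry w x.1).card

/-- The statistic `(2-13)`: the number of pairs `1 ≤ i < j ≤ n - 1` with `wⱼ₊₁ > wᵢ > wⱼ`. -/
def res (w : List ℕ) : ℕ :=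
  ((Finset.Ico 1 w.length ×ˢ Finset.Ico 1 w.length).filter fun x =>
    x.1 < x.2 ∧ entry w (x.2 + 1) > entry w x.1 ∧ entry w x.1 > entry w x.2).card

/-- The subword of `w` consisting of the letters at most `k`, in the order they appear. -/
def subword (w : List ℕ) (k : ℕ) : List ℕ := w.filter fun a => a ≤ k

/-- `σ` is an André permutation: for `1 ≤ k ≤ n`, the subword of the letters `1, …, k` has no
double descent. Since a word is followed by the boundary letter `0`, a final descent would make
the last letter a double descent, so that each subword also ends with an ascent. -/
def IsAndre {n : ℕ} (σ : Equiv.Perm (Fin n)) : Prop :=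
  ∀ k ∈ Finset.Icc 1 n, dd (subword (word σ) k) = 0

instance {n : ℕ} : DecidablePred (IsAndre (n := n)) := fun σ =>
  inferInstanceAs (Decidable (∀ k ∈ Finset.Icc 1 n, dd (subword (word σ) k) = 0))

/-- The permutations of `[n]` with `k` valleys and no double descent. -/
def gammaPerms (n k : ℕ) : Finset (Equiv.Perm (Fin n)) :=
  Finset.univ.filter fun σ => valley (word σ) = k ∧ dd (word σ) = 0

/-- The André permutations of `[n]` with `k` descents. -/
def andrePerms (n k : ℕ) : Finset (Equiv.Perm (Fin n)) :=
  Finset.univ.filter fun σ => IsAndre σ ∧ des (word σ) = k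

/-- The `(p,q)`-Eulerian polynomial `Aₙ(p,q,t)`. -/
def eulerian {R : Type*} [CommSemiring R] (n : ℕ) (p q t : R) : R :=
  ∑ σ : Equiv.Perm (Fin n), p ^ res (word σ) * q ^ les (word σ) * t ^ des (word σ)

/-- The polynomial `γₙₖ(p,q)`. -/
def gammaCoeff {R : Type*} [CommSemiring R] (n k : ℕ) (p q : R) : R :=
  ∑ σ ∈ gammaPerms n k, p ^ res (word σ) * q ^ les (word σ)

/-- The polynomial `dₙₖ(p,q)`. -/
def andreCoeff {R : Type*} [CommSemiring R] (n k : ℕ) (p q : R) : R :=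
  ∑ σ ∈ andrePerms n k, p ^ res (word σ) * q ^ (les (word σ) - k)

end PQEulerian

/-! A permutation is taken apart by deleting its letters in increasing order. Every deletion splits
a word `u ++ a :: v` into its nonempty parts among `u`, `v`, so the intermediate objects are
sequences of `h` nonempty words, with `0` understood between neighbouring words.

If the least letter `a` lies in the word with index `j`, each of the `j` earlier words has exactly
one descent over `a`, its last step down to `0`. Hence `a` adds `j` to (31-2) and, by reversal, `h -
1 - j` to (2-13). Summing over `j` gives the factor `[h] = pqNat p q h`, while the height becomes `h
+ 1`, `h` (in two ways) or `h - 1`. A descent arises when `u` is nonempty, a valley when both parts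
are, a double descent when only `u` is. So `eulerian` is a sum over weighted lattice paths with up
steps `t` and level steps `1 + t`, and `gammaCoeff n k` collects the paths with `k` up steps
(`eulerian_eq_pathSum`, `gammaCoeff_eq_pathCoeff`). This gives the first expansion.

For André permutations, `u ++ a :: v` is André iff `u` and `v` are and every letter of `u` is at
least some letter of `v`. A split into two nonempty words thus leaves a pair with a domination
condition. The next least letter cannot lie in the first word of a pair. In the second word, at
index `j`, it satisfies the condition and dissolves the pair. With one factor `q` removed, the
weight `p ^ (h-1-j) * q ^ (j-1)` times `p + q` is the total weight of the two positions `j - 1` and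
`j`. Each of the `k` descents creates one pair, and each pair is later dissolved, so multiplication
by `(p + q) ^ k` restores the recursion of `pathCoeff` (`pow_mul_andreSum`). No division is needed,
so any commutative semiring will do. -/

namespace PQEulerian

/-! ### Descents, valleys and double descents around a least letter -/

/-- The number of letters `x` of a word such that `P` holds of `x` and its two neighbours, where the
word is preceded by `p` and followed by `0`. -/
def neighbourCount (P : ℕ → ℕ → ℕ → Prop) [∀ x y z, Decidable (P x y z)] : ℕ → List ℕ → ℕ
  | _, [] => 0
  | p, x :: r => (if P p x (r.headD 0) then 1 else 0) + neighbourCount P x r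

theorem card_filter_getD_eq_neighbourCount (P : ℕ → ℕ → ℕ → Prop)
    [∀ x y z, Decidable (P x y z)] (p : ℕ) (w : List ℕ) :
    ((Finset.Icc 1 w.length).filter fun i =>
      P ((p :: w).getD (i - 1) 0) ((p :: w).getD i 0) ((p :: w).getD (i + 1) 0)).card =
      neighbourCount P p w := by
  have key : ∀ (w : List ℕ) (p : ℕ), (∑ i ∈ Finset.range w.length,
      if P ((p :: w).getD i 0) ((p :: w).getD (i + 1) 0) ((p :: w).getD (i + 2) 0)
      then 1 else 0) = neighbourCount P p w := by
    intro w
    induction w with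
    | nil => intro p; simp [neighbourCount]
    | cons x r ih =>
      intro p
      rw [List.length_cons, Finset.sum_range_succ', neighbourCount, ← ih x, add_comm]
      cases r <;> simp
  rw [Finset.card_filter, ← key, ← Finset.Ico_succ_right_eq_Icc, Finset.sum_Ico_eq_sum_range]
  refine Finset.sum_congr (by simp) fun i _ => ?_
  rw [show 1 + i - 1 = i by omega, show 1 + i = i + 1 by omega]

/-- By `hr` and `hl`, a letter above `a` cannot tell a neighbour `a` from the boundary `0`, so `u`
and `v` count as separate words and only `a` itself is new. -/
theorem neighbourCount_append_cons (P : ℕ → ℕ → ℕ → Prop) [∀ x y z, Decidable (P x y z)]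
    {a : ℕ} (hr : ∀ x y, a < y → (P x y a ↔ P x y 0)) (hl : ∀ y z, a < y → (P a y z ↔ P 0 y z))
    {u v : List ℕ} (hu : ∀ x ∈ u, a < x) (hv : ∀ x ∈ v, a < x) (p : ℕ) :
    neighbourCount P p (u ++ a :: v) = neighbourCount P p u + neighbourCount P 0 v +
      if P (u.getLastD p) a (v.headD 0) then 1 else 0 := by
  induction u generalizing p with
  | nil =>
    cases v with
    | nil => simp [neighbourCount]
    | cons y v =>
      have : a < y := hv y (by simp)
      simp [neighbourCount, hl y _ this]
      omega
  | cons x u ih =>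
    have hx : a < x := hu x (by simp)
    have := ih (fun y hy => hu y (by simp [hy])) x
    cases u with
    | nil =>
      simp only [List.nil_append, List.cons_append, neighbourCount, List.headD_cons] at this ⊢
      rw [this]
      simp [hr _ _ hx]
      omega
    | cons y u =>
      simp only [List.cons_append, neighbourCount, List.headD_cons] at this ⊢
      rw [this]
      simp only [List.getLastD_cons]
      by_cases h : P p x y <;> simp only [h, if_true, if_false] <;> omega

theorem valley_eq_neighbourCount (w : List ℕ) :
    valley w = neighbourCount (fun x y z => x > y ∧ y < z) 0 w := by
  rw [← card_filter_getD_eq_neighbourCount]; rfl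

theorem dd_eq_neighbourCount (w : List ℕ) :
    dd w = neighbourCount (fun x y z => x > y ∧ y > z) 0 w := by
  rw [← card_filter_getD_eq_neighbourCount]; rfl

theorem des_eq_neighbourCount (w : List ℕ) :
    des w = neighbourCount (fun x y _ => x > y) 0 w := by
  rw [← card_filter_getD_eq_neighbourCount, des]
  -- A descent is recorded at its lower letter. The first letter is preceded by `0` and never
  -- counts.
  refine Finset.card_bij (fun i _ => i + 1) ?_ (by simp) ?_
  · intro i hi
    rw [Finset.mem_filter, Finset.mem_Ico] at hi
    rw [Finset.mem_filter, Finset.mem_Icc]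
    exact ⟨by omega, hi.2⟩
  · intro i hi
    rw [Finset.mem_filter, Finset.mem_Icc] at hi
    obtain ⟨⟨h1, h2⟩, h3⟩ := hi
    have : i ≠ 1 := by rintro rfl; simp at h3
    refine ⟨i - 1, ?_, by omega⟩
    rw [Finset.mem_filter, Finset.mem_Ico, entry, show i - 1 + 1 = i by omega]
    exact ⟨by omega, h3⟩

theorem getLastD_zero_of_forall_lt {a : ℕ} {u : List ℕ} (hu : ∀ x ∈ u, a < x) :
    a < u.getLastD 0 ↔ u ≠ [] := by
  cases u with
  | nil => simp
  | cons x u =>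
    rw [List.getLastD_cons, ← List.getLast_eq_getLastD]
    simpa using hu _ (List.getLast_mem (List.cons_ne_nil x u))

section

variable {a : ℕ} {u v : List ℕ}

theorem valley_append_cons (hu : ∀ x ∈ u, a < x) (hv : ∀ x ∈ v, a < x) :
    valley (u ++ a :: v) = valley u + valley v + if u ≠ [] ∧ v ≠ [] then 1 else 0 := by
  simp only [valley_eq_neighbourCount]
  rw [neighbourCount_append_cons _ (by intros; omega) (by intros; omega) hu hv]
  congr 1
  refine if_congr (and_congr (getLastD_zero_of_forall_lt hu) ?_) rfl rfl
  cases v with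
  | nil => simp
  | cons y v => simpa using hv y (by simp)

theorem dd_append_cons (ha : 0 < a) (hu : ∀ x ∈ u, a < x) (hv : ∀ x ∈ v, a < x) :
    dd (u ++ a :: v) = dd u + dd v + if u ≠ [] ∧ v = [] then 1 else 0 := by
  simp only [dd_eq_neighbourCount]
  rw [neighbourCount_append_cons _ (by intros; omega) (by intros; omega) hu hv]
  congr 1
  refine if_congr (and_congr (getLastD_zero_of_forall_lt hu) ?_) rfl rfl
  cases v with
  | nil => simpa
  | cons y v => simpa using (hv y (by simp)).le

theorem des_append_cons (hu : ∀ x ∈ u, a < x) (hv : ∀ x ∈ v, a < x) :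
    des (u ++ a :: v) = des u + des v + if u ≠ [] then 1 else 0 := by
  simp only [des_eq_neighbourCount]
  rw [neighbourCount_append_cons _ (by intros; omega) (by intros; omega) hu hv]
  congr 1
  exact if_congr (getLastD_zero_of_forall_lt hu) rfl rfl

end

/-! ### The statistics (31-2) and (2-13) of a word -/

/-- The number of descents `x > y` of the word `w`, followed by `0`, with `x > c > y`. -/
def descentsOver (c : ℕ) : List ℕ → ℕ
  | [] => 0
  | x :: r => descentsOver c r + if c < x ∧ r.headD 0 < c then 1 else 0

/-- A recursive form of the statistic `(31-2)`. -/
def lesRec : List ℕ → ℕ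
  | [] => 0
  | x :: r => lesRec r + r.countP fun c => c < x ∧ r.headD 0 < c

theorem sum_range_getD_eq_countP (Q : ℕ → Prop) [DecidablePred Q] (l : List ℕ) :
    (∑ j ∈ Finset.range l.length, if Q (l.getD j 0) then 1 else 0) = l.countP fun c => Q c := by
  induction l with
  | nil => simp
  | cons x l ih =>
    rw [List.length_cons, Finset.sum_range_succ', List.countP_cons, ← ih]
    simp

theorem les_eq_lesRec (w : List ℕ) : les w = lesRec w := by
  have key : ∀ w : List ℕ, (∑ i ∈ Finset.range (w.length - 1), ∑ j ∈ Finset.range (w.length - 1),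
      if i < j ∧ w.getD i 0 > w.getD (j + 1) 0 ∧ w.getD (j + 1) 0 > w.getD (i + 1) 0
      then 1 else 0) = lesRec w := by
    intro w
    induction w with
    | nil => simp [lesRec]
    | cons x r ih =>
      cases r with
      | nil => simp [lesRec]
      | cons y r =>
        rw [lesRec, ← ih]
        simp only [List.length_cons, Nat.add_sub_cancel]
        rw [Finset.sum_range_succ']
        congr 1
        · refine Finset.sum_congr rfl fun i _ => ?_
          rw [Finset.sum_range_succ']
          simp
        · rw [Finset.sum_range_succ', List.countP_cons, ← sum_range_getD_eq_countP]
          simp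
  rw [← key, les, Finset.card_filter, Finset.sum_product]
  simp only [← Finset.Ico_succ_right_eq_Icc]
  rw [Finset.sum_Ico_eq_sum_range]
  refine Finset.sum_congr (by simp) fun i _ => ?_
  rw [Finset.sum_Ico_eq_sum_range]
  refine Finset.sum_congr (by simp) fun j _ => ?_
  simp only [entry]
  rw [show 2 + i - 1 = i + 1 by omega, show 2 + i = i + 1 + 1 by omega,
    show 2 + j = j + 1 + 1 by omega]
  simp

theorem entry_reverse {w : List ℕ} {i : ℕ} (h1 : 1 ≤ i) (h2 : i ≤ w.length) :
    entry w.reverse i = entry w (w.length + 1 - i) := by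
  obtain ⟨i, rfl⟩ : ∃ k, i = k + 1 := ⟨i - 1, by omega⟩
  rw [show w.length + 1 - (i + 1) = (w.length - 1 - i) + 1 by omega]
  simp only [entry, List.getD_cons_succ]
  rw [List.getD_eq_getElem?_getD, List.getD_eq_getElem?_getD, List.getElem?_reverse (by omega)]

theorem res_eq_les_reverse (w : List ℕ) : res w = les w.reverse := by
  rw [res, les]
  refine Finset.card_nbij' (fun x => (w.length + 1 - x.2, w.length + 1 - x.1))
    (fun x => (w.length + 1 - x.2, w.length + 1 - x.1)) ?_ ?_ ?_ ?_
  · rintro ⟨i, j⟩ h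
    simp only [Finset.coe_filter, Finset.mem_product, Finset.mem_Ico, Finset.mem_Icc,
      List.length_reverse, Set.mem_ofPred_eq] at h ⊢
    obtain ⟨⟨⟨h1, h2⟩, h3, h4⟩, h5, h6⟩ := h
    refine ⟨by omega, by omega, ?_⟩
    rw [entry_reverse (by omega) (by omega), entry_reverse (by omega) (by omega),
      entry_reverse (by omega) (by omega)]
    rw [show w.length + 1 - (w.length + 1 - j - 1) = j + 1 by omega,
      show w.length + 1 - (w.length + 1 - j) = j by omega,
      show w.length + 1 - (w.length + 1 - i) = i by omega]
    exact h6
  · rintro ⟨i, j⟩ h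
    simp only [Finset.coe_filter, Finset.mem_product, Finset.mem_Ico, Finset.mem_Icc,
      List.length_reverse, Set.mem_ofPred_eq] at h ⊢
    obtain ⟨⟨⟨h1, h2⟩, h3, h4⟩, h5, h6⟩ := h
    refine ⟨by omega, by omega, ?_⟩
    rw [entry_reverse (by omega) (by omega), entry_reverse (by omega) (by omega),
      entry_reverse (by omega) (by omega)] at h6
    rw [show w.length + 1 - (i - 1) = w.length + 1 - i + 1 by omega] at h6
    exact h6
  · rintro ⟨i, j⟩ h
    simp only [Finset.coe_filter, Finset.mem_product, Finset.mem_Ico, Set.mem_ofPred_eq] at h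
    ext <;> simp <;> omega
  · rintro ⟨i, j⟩ h
    simp only [Finset.coe_filter, Finset.mem_product, Finset.mem_Icc, List.length_reverse,
      Set.mem_ofPred_eq] at h
    ext <;> simp <;> omega

section

variable {a : ℕ} {u v : List ℕ}

/-- The letter `a` is never the 2 of a pattern, and the step from `u` down to `a` lies over the same
letters of `v` as a step down to `0`. -/
theorem lesRec_append_cons (hu : ∀ x ∈ u, a < x) (hv : ∀ x ∈ v, a < x) :
    lesRec (u ++ a :: v) = lesRec u + lesRec v + (v.map fun c => descentsOver c u).sum := by
  induction u with
  | nil =>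
    simp only [List.nil_append, lesRec, descentsOver, List.map_const', List.sum_replicate]
    rw [List.countP_eq_zero.2]
    · simp
    · intro c hc
      have := hv c hc
      simp only [decide_eq_true_eq]
      omega
  | cons x u ih =>
    have hu' : ∀ y ∈ u, a < y := fun y hy => hu y (by simp [hy])
    rw [List.cons_append, lesRec, ih hu', lesRec]
    simp only [descentsOver, List.sum_map_add]
    have h1 : (v.map fun c => if c < x ∧ u.headD 0 < c then 1 else 0).sum =
        v.countP fun c => c < x ∧ (u ++ a :: v).headD 0 < c := by
      clear ih
      have : ∀ c ∈ v, (u.headD 0 < c ↔ (u ++ a :: v).headD 0 < c) := by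
        intro c hc
        have := hv c hc
        cases u
        · simp; omega
        · simp
      generalize (u ++ a :: v).headD 0 = z at this
      induction v with
      | nil => simp
      | cons c v ihv =>
        rw [List.map_cons, List.sum_cons, List.countP_cons,
          ihv (fun x hx => hv x (by simp [hx])) (fun x hx => this x (by simp [hx])), add_comm]
        simp only [this c (by simp), decide_eq_true_eq]
    have h2 : (u ++ a :: v).countP (fun c => c < x ∧ (u ++ a :: v).headD 0 < c) =
        u.countP (fun c => c < x ∧ u.headD 0 < c) +
          v.countP (fun c => c < x ∧ (u ++ a :: v).headD 0 < c) := by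
      rw [List.countP_append, List.countP_cons]
      have : ¬ (a < x ∧ (u ++ a :: v).headD 0 < a) := by
        cases u with
        | nil => simp
        | cons y u => have := hu' y (by simp); simp; omega
      cases u
      · simp
      · simp at this ⊢; omega
    rw [h1, h2]
    omega

theorem descentsOver_append_cons {c : ℕ} (hc : a < c) (u v : List ℕ) :
    descentsOver c (u ++ a :: v) = descentsOver c u + descentsOver c v := by
  induction u with
  | nil => simp [descentsOver, hc.not_gt]
  | cons x u ih =>
    rw [List.cons_append, descentsOver, ih, descentsOver]
    cases u
    · simp [hc, (Nat.zero_le a).trans_lt hc]; omega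
    · simp; omega

/-- Only the last step, down to `0`, passes `a`. -/
theorem descentsOver_of_forall_lt (ha : 0 < a) (hu : ∀ x ∈ u, a < x) (hne : u ≠ []) :
    descentsOver a u = 1 := by
  induction u with
  | nil => exact absurd rfl hne
  | cons x u ih =>
    have hx : a < x := hu x (by simp)
    cases u with
    | nil => simp [descentsOver, hx, ha]
    | cons y u =>
      have hy : a < y := hu y (by simp)
      rw [descentsOver, ih (fun z hz => hu z (by simp [hz])) (by simp)]
      simp; omega

end

/-! ### The statistics of a sequence of words -/

/-- The statistic `(31-2)` of a sequence of words, each of which is followed by a letter `0`. -/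
def lesSeq : List (List ℕ) → ℕ
  | [] => 0
  | w :: L => lesRec w + (L.flatten.map fun c => descentsOver c w).sum + lesSeq L

/-- The statistic `(2-13)` of a sequence of words, each of which is preceded by a letter `0`. -/
def resSeq (L : List (List ℕ)) : ℕ := lesSeq (L.map List.reverse).reverse

/-- The word `u` as a sequence of at most one nonempty word. -/
def run (u : List ℕ) : List (List ℕ) := if u = [] then [] else [u]

@[simp] theorem run_nil : run [] = [] := rfl

@[simp] theorem flatten_run (u : List ℕ) : (run u).flatten = u := by
  by_cases h : u = [] <;> simp [run, h]

theorem map_reverse_run (u : List ℕ) : (run u).map List.reverse = run u.reverse := by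
  by_cases h : u = [] <;> simp [run, h]

@[simp] theorem reverse_run (u : List ℕ) : (run u).reverse = run u := by
  by_cases h : u = [] <;> simp [run, h]

theorem mem_run {u w : List ℕ} : w ∈ run u ↔ w = u ∧ u ≠ [] := by
  by_cases h : u = [] <;> simp [run, h]

theorem descentsOver_nil (c : ℕ) : descentsOver c [] = 0 := rfl

theorem lesSeq_append_run (A : List (List ℕ)) (u : List ℕ) (R : List (List ℕ)) :
    lesSeq (A ++ (run u ++ R)) = lesSeq (A ++ u :: R) := by
  induction A with
  | nil =>
    by_cases h : u = []
    · simp [h, lesSeq, lesRec, descentsOver_nil, -List.map_flatten]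
    · simp [run, h]
  | cons w A ih => simp [lesSeq, ih]

/-- Every word of `A` passes `a` exactly once, which gives `A.length`. Splitting at `a` changes
nothing else, since `a` acts as a `0` for the larger letters. -/
theorem lesSeq_append_cons {a : ℕ} (ha : 0 < a) {A R : List (List ℕ)} {u v : List ℕ}
    (hA : ∀ w ∈ A, w ≠ [] ∧ ∀ x ∈ w, a < x) (hu : ∀ x ∈ u, a < x) (hv : ∀ x ∈ v, a < x)
    (hR : ∀ w ∈ R, ∀ x ∈ w, a < x) :
    lesSeq (A ++ (u ++ a :: v) :: R) = lesSeq (A ++ (run u ++ (run v ++ R))) + A.length := by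
  rw [lesSeq_append_run, show A ++ u :: (run v ++ R) = (A ++ [u]) ++ (run v ++ R) by simp,
    lesSeq_append_run]
  induction A with
  | nil =>
    have : (R.flatten.map fun c => descentsOver c (u ++ a :: v)) =
        R.flatten.map fun c => descentsOver c u + descentsOver c v := by
      refine List.map_congr_left fun c hc => ?_
      obtain ⟨w, hw, hcw⟩ := List.mem_flatten.1 hc
      exact descentsOver_append_cons (hR w hw c hcw) u v
    simp [lesSeq, this, lesRec_append_cons hu hv, List.sum_map_add, -List.map_flatten]
    omega
  | cons w A ih =>
    have hw := hA w (by simp)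
    have := descentsOver_of_forall_lt ha hw.2 hw.1
    simp [lesSeq, ih fun w hw => hA w (by simp [hw]), this, -List.map_flatten]
    omega

/-- The mirror image of `lesSeq_append_cons`: reversal exchanges `A` with `R` and `u` with `v`. -/
theorem resSeq_append_cons {a : ℕ} (ha : 0 < a) {A R : List (List ℕ)} {u v : List ℕ}
    (hA : ∀ w ∈ A, ∀ x ∈ w, a < x) (hu : ∀ x ∈ u, a < x) (hv : ∀ x ∈ v, a < x)
    (hR : ∀ w ∈ R, w ≠ [] ∧ ∀ x ∈ w, a < x) :
    resSeq (A ++ (u ++ a :: v) :: R) = resSeq (A ++ (run u ++ (run v ++ R))) + R.length := by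
  have := lesSeq_append_cons ha (A := (R.map List.reverse).reverse)
    (R := (A.map List.reverse).reverse) (u := v.reverse) (v := u.reverse)
    (fun w hw => by simpa using hR w.reverse (by simpa using hw)) (by simpa using hv)
    (by simpa using hu) (fun w hw => by simpa using hA w.reverse (by simpa using hw))
  simpa [resSeq, map_reverse_run] using this

theorem sum_map_run {f : List ℕ → ℕ} (hf : f [] = 0) (u : List ℕ) :
    ((run u).map f).sum = f u := by
  by_cases h : u = [] <;> simp [run, h, hf]

/-! ### Insertion of a least letter and arrangements -/

/-- Insert the letter `a` in front of a sequence of words as a word of its own, or glue it to the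
end of the first word, to the start of the first word, or between the first two words. The two
flags tell whether something precedes or follows `a` in its word. -/
def glue (a : ℕ) : Bool × Bool → List (List ℕ) → List (List ℕ)
  | (false, false), L => [a] :: L
  | (false, true), w :: L => (a :: w) :: L
  | (true, false), w :: L => (w ++ [a]) :: L
  | (true, true), u :: v :: L => (u ++ a :: v) :: L
  | _, L => L

/-- Insert the letter `a` in such a way that it lies in the word with index `j`. -/
def insertMin (a j : ℕ) (c : Bool × Bool) (L : List (List ℕ)) : List (List ℕ) :=
  L.take j ++ glue a c (L.drop j)

/-- The sequences of `h` nonempty words which together are an arrangement of the letters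
`a, …, a + m - 1`, obtained by inserting these letters in decreasing order. -/
def arrangements : ℕ → ℕ → ℕ → Multiset (List (List ℕ))
  | 0, _, h => if h = 0 then {[]} else 0
  | m + 1, a, h => ∑ j ∈ Finset.range h, ∑ c : Bool × Bool,
      (arrangements m (a + 1) (h - 1 + c.1.toNat + c.2.toNat)).map (insertMin a j c)

theorem glue_run (a : ℕ) (u v : List ℕ) (R : List (List ℕ)) :
    glue a (!u.isEmpty, !v.isEmpty) (run u ++ (run v ++ R)) = (u ++ a :: v) :: R := by
  cases u <;> cases v <;> simp [run, glue]

theorem exists_eq_run_append {a : ℕ} (c : Bool × Bool) {L : List (List ℕ)}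
    (hL : ∀ w ∈ L, w ≠ [] ∧ ∀ x ∈ w, a < x) (hlen : c.1.toNat + c.2.toNat ≤ L.length) :
    ∃ u v R, L = run u ++ (run v ++ R) ∧ c = (!u.isEmpty, !v.isEmpty) ∧
      L.length = R.length + c.1.toNat + c.2.toNat := by
  obtain ⟨c1, c2⟩ := c
  cases c1 <;> cases c2
  · exact ⟨[], [], L, by simp⟩
  · obtain _ | ⟨w, L⟩ := L
    · simp at hlen
    have hw := (hL w (by simp)).1
    exact ⟨[], w, L, by simp [run, hw]⟩
  · obtain _ | ⟨w, L⟩ := L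
    · simp at hlen
    have hw := (hL w (by simp)).1
    exact ⟨w, [], L, by simp [run, hw]⟩
  · obtain _ | ⟨w, _ | ⟨w', L⟩⟩ := L
    · simp at hlen
    · simp at hlen
    have hw := (hL w (by simp)).1
    have hw' := (hL w' (by simp)).1
    exact ⟨w, w', L, by simp [run, hw, hw']⟩

/-- The decomposition of a sequence of words around the place where the letter `a`, which is less
than all its letters, is inserted. -/
structure IsInsertion (a j h : ℕ) (c : Bool × Bool) (L : List (List ℕ))
    (A : List (List ℕ)) (u v : List ℕ) (R : List (List ℕ)) : Prop where
  length_left : A.length = j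
  length_right : R.length = h - 1 - j
  eq_append : L = A ++ (run u ++ (run v ++ R))
  insert_eq : insertMin a j c L = A ++ (u ++ a :: v) :: R
  flags : c = (!u.isEmpty, !v.isEmpty)
  left : ∀ w ∈ A, w ≠ [] ∧ ∀ x ∈ w, a < x
  mid_left : ∀ x ∈ u, a < x
  mid_right : ∀ x ∈ v, a < x
  right : ∀ w ∈ R, w ≠ [] ∧ ∀ x ∈ w, a < x

theorem exists_isInsertion {a j h : ℕ} (hj : j < h) (c : Bool × Bool) {L : List (List ℕ)}
    (hL : ∀ w ∈ L, w ≠ [] ∧ ∀ x ∈ w, a < x) (hlen : L.length = h - 1 + c.1.toNat + c.2.toNat) :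
    ∃ A u v R, IsInsertion a j h c L A u v R := by
  obtain ⟨u, v, R, h1, h2, h3⟩ := exists_eq_run_append (a := a) c (L := L.drop j)
    (fun w hw => hL w (List.mem_of_mem_drop hw)) (by rw [List.length_drop]; omega)
  have h4 : L = L.take j ++ (run u ++ (run v ++ R)) := by rw [← h1, List.take_append_drop]
  have hmem : ∀ w ∈ run u ++ (run v ++ R), w ∈ L := fun w hw => by
    rw [h4]; exact List.mem_append_right _ hw
  refine ⟨L.take j, u, v, R, ?_, ?_, h4, ?_, h2, ?_, ?_, ?_, ?_⟩
  · rw [List.length_take]; omega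
  · rw [List.length_drop] at h3; omega
  · rw [insertMin, h1, h2, glue_run]
  · exact fun w hw => hL w (List.mem_of_mem_take hw)
  · intro x hx
    refine (hL u (hmem u ?_)).2 x hx
    simp [mem_run, List.ne_nil_of_mem hx]
  · intro x hx
    refine (hL v (hmem v ?_)).2 x hx
    simp [mem_run, List.ne_nil_of_mem hx]
  · exact fun w hw => hL w (hmem w (by simp [hw]))

theorem mem_arrangements_succ {m a h : ℕ} {L : List (List ℕ)} :
    L ∈ arrangements (m + 1) a h ↔ ∃ j < h, ∃ c : Bool × Bool,
      ∃ C ∈ arrangements m (a + 1) (h - 1 + c.1.toNat + c.2.toNat), insertMin a j c C = L := by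
  simp only [arrangements, Multiset.mem_sum, Finset.mem_range, Finset.mem_univ, true_and,
    Multiset.mem_map]

theorem of_mem_arrangements {m a h : ℕ} {L : List (List ℕ)} (hL : L ∈ arrangements m a h) :
    L.length = h ∧ ∀ w ∈ L, w ≠ [] ∧ ∀ x ∈ w, a ≤ x := by
  induction m generalizing a h L with
  | zero =>
    by_cases h0 : h = 0
    · simp only [arrangements, h0, if_true, Multiset.mem_singleton] at hL
      simp [hL, h0]
    · simp [arrangements, h0] at hL
  | succ m ih =>
    obtain ⟨j, hj, c, C, hC, rfl⟩ := mem_arrangements_succ.1 hL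
    obtain ⟨h1, h2⟩ := ih hC
    obtain ⟨A, u, v, R, H⟩ := exists_isInsertion hj c h2 h1
    rw [H.insert_eq]
    constructor
    · simp [H.length_left, H.length_right]; omega
    · intro w hw
      rw [List.mem_append, List.mem_cons] at hw
      rcases hw with hw | rfl | hw
      · exact ⟨(H.left w hw).1, fun x hx => ((H.left w hw).2 x hx).le⟩
      · refine ⟨by simp, fun x hx => ?_⟩
        rw [List.mem_append, List.mem_cons] at hx
        rcases hx with hx | rfl | hx
        · exact (H.mid_left x hx).le
        · exact le_rfl
        · exact (H.mid_right x hx).le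
      · exact ⟨(H.right w hw).1, fun x hx => ((H.right w hw).2 x hx).le⟩

theorem exists_isInsertion_of_mem {m a j h : ℕ} (hj : j < h) (c : Bool × Bool)
    {L : List (List ℕ)} (hL : L ∈ arrangements m (a + 1) (h - 1 + c.1.toNat + c.2.toNat)) :
    ∃ A u v R, IsInsertion a j h c L A u v R :=
  exists_isInsertion hj c (of_mem_arrangements hL).2 (of_mem_arrangements hL).1

/-- The least letter is found in its word and deleted, which undoes one insertion. -/
theorem mem_arrangements {m a h : ℕ} {L : List (List ℕ)} (hlen : L.length = h)
    (hne : ∀ w ∈ L, w ≠ []) (hperm : L.flatten.Perm (List.range' a m)) :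
    L ∈ arrangements m a h := by
  induction m generalizing a h L with
  | zero =>
    have : L = [] := by
      rw [List.range'_zero, List.perm_nil, List.flatten_eq_nil_iff] at hperm
      exact List.eq_nil_iff_forall_not_mem.2 fun w hw => hne w hw (hperm w hw)
    subst this
    simp [arrangements, ← hlen]
  | succ m ih =>
    obtain ⟨w, hw, haw⟩ := List.mem_flatten.1
      (hperm.mem_iff.2 (by simp [List.mem_range'] : a ∈ List.range' a (m + 1)))
    obtain ⟨A, R, rfl⟩ := List.append_of_mem hw
    obtain ⟨u, v, rfl⟩ := List.append_of_mem haw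
    refine mem_arrangements_succ.2 ⟨A.length, by simp [← hlen], (!u.isEmpty, !v.isEmpty),
      A ++ (run u ++ (run v ++ R)), ih ?_ ?_ ?_, ?_⟩
    · rw [← hlen]
      cases u <;> cases v <;> simp [run] <;> omega
    · intro w hw
      simp only [List.mem_append, mem_run] at hw
      rcases hw with hw | ⟨rfl, hw⟩ | ⟨rfl, hw⟩ | hw
      · exact hne w (by simp [hw])
      · exact hw
      · exact hw
      · exact hne w (by simp [hw])
    · rw [List.range'_succ] at hperm
      refine (List.perm_cons a).1 (List.Perm.trans ?_ hperm)
      simp only [List.flatten_append, flatten_run, List.flatten_cons, List.append_assoc,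
        List.cons_append]
      rw [← List.append_assoc, ← List.append_assoc A.flatten]
      exact List.perm_middle.symm
    · rw [insertMin, List.take_left, List.drop_left, glue_run]

/-- A permutation of the letters is cut at `h - 1` of its `m` gaps. The factor `min h 1` covers `h =
0`, where `h - 1` truncates to `0`. -/
theorem card_arrangements_succ (m a h : ℕ) :
    (arrangements (m + 1) a h).card = (m + 1).factorial * m.choose (h - 1) * min h 1 := by
  induction m generalizing a h with
  | zero =>
    obtain _ | _ | _ | h := h <;>
    simp [arrangements, Fintype.sum_prod_type]
  | succ m ih =>
    rw [arrangements]
    simp only [Multiset.card_sum, Multiset.card_add, Multiset.card_map, Fintype.sum_prod_type, Fintype.sum_bool, ih,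
      Bool.toNat_true, Bool.toNat_false, Finset.sum_const, Finset.card_range, smul_eq_mul]
    obtain _ | _ | h := h
    · simp
    · simp [Nat.factorial_succ]; ring
    -- The four flags give binomials that Pascal's rule merges in two rounds; `e1` then absorbs the
    -- factor from the choice of `j`.
    · have e1 := Nat.add_one_mul_choose_eq (m + 1) (h + 1)
      have e2 := Nat.choose_succ_succ (m + 1) (h + 1)
      have e3 := Nat.choose_succ_succ m (h + 1)
      have e4 := Nat.choose_succ_succ m h
      simp only [Nat.succ_eq_add_one] at e1 e2 e3 e4
      have e5 : m.choose (h + 1 + 1) + m.choose (h + 1) + (m.choose (h + 1) + m.choose h) =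
          (m + 1 + 1).choose (h + 1 + 1) := by omega
      simp only [Nat.add_sub_cancel, Nat.add_zero, Nat.factorial_succ (m + 1),
        show ∀ k, min (k + 1) 1 = 1 by simp, show h + 2 - 1 = h + 1 by omega, mul_one,
        ← mul_add, e5]
      rw [mul_left_comm, mul_comm (h + 1 + 1), ← e1]
      ring

/-! ### Permutations as arrangements in one word -/

theorem word_injective (n : ℕ) : Function.Injective (word (n := n)) := by
  intro σ τ h
  ext i
  have := congrFun (List.ofFn_injective h) i
  simpa using this

theorem word_perm_range' {n : ℕ} (σ : Equiv.Perm (Fin n)) :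
    (word σ).Perm (List.range' 1 n) := by
  have h1 : List.range' 1 n = List.ofFn fun i : Fin n => (i : ℕ) + 1 := by
    apply List.ext_getElem <;> simp [add_comm]
  rw [h1, word]
  exact Equiv.Perm.ofFn_comp_perm σ fun i : Fin n => (i : ℕ) + 1

/-- Inclusion and equal cardinality suffice, so it need not be shown directly that different
insertions give different results. -/
theorem map_word_eq_arrangements {n : ℕ} (hn : 1 ≤ n) :
    (Finset.univ.val.map fun σ : Equiv.Perm (Fin n) => [word σ]) = arrangements n 1 1 := by
  refine Multiset.eq_of_le_of_card_le ((Multiset.le_iff_subset ?_).2 ?_) ?_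
  · exact Finset.univ.nodup.map fun σ τ h => word_injective n (by simpa using h)
  · intro L hL
    obtain ⟨σ, -, rfl⟩ := Multiset.mem_map.1 hL
    refine mem_arrangements rfl ?_ (by simpa using word_perm_range' σ)
    simp only [List.mem_singleton, forall_eq]
    intro h
    have := congrArg List.length h
    simp [word] at this
    omega
  · obtain ⟨n, rfl⟩ : ∃ k, n = k + 1 := ⟨n - 1, by omega⟩
    rw [card_arrangements_succ]
    simp [Fintype.card_perm]

/-! ### Weighted lattice paths -/

/-- The `(p,q)`-analogue of the natural number `h`. -/
def pqNat {R : Type*} [CommSemiring R] (p q : R) (h : ℕ) : R :=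
  ∑ j ∈ Finset.range h, p ^ (h - 1 - j) * q ^ j

/-- The weighted sum over the lattice paths of length `m` from height `h` to `0` with steps
`1`, `0`, `-1`; a step from height `i` has weight `[i]` times `x`, `y` and `1`, respectively. -/
def pathSum {R : Type*} [CommSemiring R] (p q x y : R) : ℕ → ℕ → R
  | 0, h => if h = 0 then 1 else 0
  | m + 1, h => pqNat p q h *
      (x * pathSum p q x y m (h + 1) + y * pathSum p q x y m h + pathSum p q x y m (h - 1))

/-- The part of `pathSum` that comes from the paths with `k` up steps. -/
def pathCoeff {R : Type*} [CommSemiring R] (p q : R) : ℕ → ℕ → ℕ → R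
  | 0, h, k => if h = 0 ∧ k = 0 then 1 else 0
  | m + 1, h, 0 => pqNat p q h * (pathCoeff p q m h 0 + pathCoeff p q m (h - 1) 0)
  | m + 1, h, k + 1 => pqNat p q h *
      (pathCoeff p q m (h + 1) k + pathCoeff p q m h (k + 1) + pathCoeff p q m (h - 1) (k + 1))

section

variable {R : Type*} [CommSemiring R] (p q : R)

theorem pqNat_zero : pqNat p q 0 = 0 := by simp [pqNat]

/-- A path from `h` to `0` with `k` up steps has `h + k` down steps. -/
theorem pathCoeff_eq_zero {m h k : ℕ} (hlt : m < h + 2 * k) : pathCoeff p q m h k = 0 := by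
  induction m generalizing h k with
  | zero => rw [pathCoeff, if_neg (by omega)]
  | succ m ih =>
    obtain _ | h := h
    · cases k <;> simp [pathCoeff, pqNat_zero]
    · cases k with
      | zero => rw [pathCoeff, ih (by omega), ih (by omega)]; simp
      | succ k => rw [pathCoeff, ih (by omega), ih (by omega), ih (by omega)]; simp

theorem pathSum_eq_sum_pathCoeff (x y : R) (m h : ℕ) : pathSum p q x y m h =
    ∑ k ∈ Finset.range (m + 1), pathCoeff p q m h k * x ^ k * y ^ (m - h - 2 * k) := by
  induction m generalizing h with
  | zero => simp [pathSum, pathCoeff]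
  | succ m ih =>
    obtain _ | h := h
    · rw [pathSum, pqNat_zero, zero_mul, eq_comm]
      refine Finset.sum_eq_zero fun k _ => ?_
      cases k <;> simp [pathCoeff, pqNat_zero]
    have h1 : y * pathSum p q x y m (h + 1) = ∑ k ∈ Finset.range (m + 1 + 1),
        pathCoeff p q m (h + 1) k * x ^ k * y ^ (m + 1 - (h + 1) - 2 * k) := by
      rw [Finset.sum_range_succ, pathCoeff_eq_zero (k := m + 1) p q (by omega), ih, Finset.mul_sum]
      simp only [zero_mul, add_zero]
      refine Finset.sum_congr rfl fun k _ => ?_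
      -- Where the exponent of `y` would truncate, the coefficient vanishes.
      by_cases hk : m < h + 1 + 2 * k
      · simp [pathCoeff_eq_zero p q hk]
      · rw [show m + 1 - (h + 1) - 2 * k = m - (h + 1) - 2 * k + 1 by omega]
        ring
    have h2 : pathSum p q x y m h = ∑ k ∈ Finset.range (m + 1 + 1),
        pathCoeff p q m h k * x ^ k * y ^ (m + 1 - (h + 1) - 2 * k) := by
      rw [Finset.sum_range_succ, pathCoeff_eq_zero (k := m + 1) p q (by omega), ih]
      simp
    rw [pathSum, h1, Nat.add_sub_cancel, h2, ih, Finset.sum_range_succ' _ (m + 1),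
      Finset.sum_range_succ' _ (m + 1), Finset.sum_range_succ' _ (m + 1)]
    simp only [pathCoeff, Nat.add_sub_cancel, mul_add, add_mul, Finset.mul_sum,
      Finset.sum_add_distrib]
    have h3 : ∀ k, m + 1 - (h + 1) - (2 * k + 2 * 1) = m - (h + 1 + 1) - 2 * k := fun k => by omega
    simp only [h3, pow_succ]
    have h4 : ∑ k ∈ Finset.range (m + 1), pqNat p q (h + 1) *
        (x * (pathCoeff p q m (h + 1 + 1) k * x ^ k * y ^ (m - (h + 1 + 1) - 2 * k))) =
        ∑ k ∈ Finset.range (m + 1), pqNat p q (h + 1) *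
        pathCoeff p q m (h + 1 + 1) k * (x ^ k * x) * y ^ (m - (h + 1 + 1) - 2 * k) :=
      Finset.sum_congr rfl fun k _ => by ring
    rw [h4]
    simp only [mul_assoc]
    abel

theorem pathSum_eq_sum_range (x y : R) {n : ℕ} (hn : 1 ≤ n) : pathSum p q x y n 1 =
    ∑ k ∈ Finset.range ((n - 1) / 2 + 1),
      pathCoeff p q n 1 k * x ^ k * y ^ (n - 1 - 2 * k) := by
  rw [pathSum_eq_sum_pathCoeff, eq_comm]
  refine Finset.sum_subset (Finset.range_subset_range.2 (by omega)) fun k _ hk => ?_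
  rw [Finset.mem_range] at hk
  rw [pathCoeff_eq_zero p q (by omega)]
  simp

/-! ### Sums over arrangements -/

/-- The sum of the values of `f` at the arrangements of `m` letters in `h` words. -/
def arrangementSum (m a h : ℕ) (f : List (List ℕ) → R) : R :=
  ((arrangements m a h).map f).sum

variable {p q}

theorem arrangementSum_succ (m a h : ℕ) (f : List (List ℕ) → R) :
    arrangementSum (m + 1) a h f = ∑ j ∈ Finset.range h, ∑ c : Bool × Bool,
      arrangementSum m (a + 1) (h - 1 + c.1.toNat + c.2.toNat) fun L => f (insertMin a j c L) := by
  simp only [arrangementSum, arrangements, ← Multiset.mapAddMonoidHom_apply,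
    ← Multiset.coe_sumAddMonoidHom, map_sum]
  simp

theorem arrangementSum_congr {m a h : ℕ} {f g : List (List ℕ) → R}
    (H : ∀ L ∈ arrangements m a h, f L = g L) : arrangementSum m a h f = arrangementSum m a h g :=
  congrArg Multiset.sum (Multiset.map_congr rfl H)

theorem arrangementSum_mul (m a h : ℕ) (r : R) (f : List (List ℕ) → R) :
    (arrangementSum m a h fun L => r * f L) = r * arrangementSum m a h f :=
  Multiset.sum_map_mul_left

theorem arrangementSum_zero (m a h : ℕ) :
    (arrangementSum m a h fun _ => (0 : R)) = 0 := by simp [arrangementSum]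

/-- Since `g` does not depend on `j`, the sum over the position factors out as `[h]`. -/
theorem arrangementSum_succ_of_forall {m a h : ℕ} {f : List (List ℕ) → R}
    {g : Bool × Bool → List (List ℕ) → R}
    (H : ∀ j < h, ∀ c L A u v S, IsInsertion a j h c L A u v S →
      f (A ++ (u ++ a :: v) :: S) = p ^ (h - 1 - j) * q ^ j * g c L) :
    arrangementSum (m + 1) a h f = pqNat p q h *
      ∑ c : Bool × Bool, arrangementSum m (a + 1) (h - 1 + c.1.toNat + c.2.toNat) (g c) := by
  rw [arrangementSum_succ, pqNat, Finset.sum_mul]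
  refine Finset.sum_congr rfl fun j hj => ?_
  rw [Finset.mul_sum]
  refine Finset.sum_congr rfl fun c _ => ?_
  rw [← arrangementSum_mul]
  refine arrangementSum_congr fun L hL => ?_
  obtain ⟨A, u, v, S, hI⟩ := exists_isInsertion_of_mem (Finset.mem_range.1 hj) c hL
  rw [hI.insert_eq]
  exact H j (Finset.mem_range.1 hj) c L A u v S hI

end

namespace IsInsertion

variable {a j h : ℕ} {c : Bool × Bool} {L A S : List (List ℕ)} {u v : List ℕ}

theorem lesSeq_eq (H : IsInsertion a j h c L A u v S) (ha : 0 < a) :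
    lesSeq (A ++ (u ++ a :: v) :: S) = lesSeq L + j := by
  rw [lesSeq_append_cons ha H.left H.mid_left H.mid_right fun w hw => (H.right w hw).2,
    ← H.eq_append, H.length_left]

theorem resSeq_eq (H : IsInsertion a j h c L A u v S) (ha : 0 < a) :
    resSeq (A ++ (u ++ a :: v) :: S) = resSeq L + (h - 1 - j) := by
  rw [resSeq_append_cons ha (fun w hw => (H.left w hw).2) H.mid_left H.mid_right H.right,
    ← H.eq_append, H.length_right]

theorem sum_map_eq (H : IsInsertion a j h c L A u v S) {f : List ℕ → ℕ} (hf : f [] = 0) {e : ℕ}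
    (he : f (u ++ a :: v) = f u + f v + e) :
    ((A ++ (u ++ a :: v) :: S).map f).sum = (L.map f).sum + e := by
  rw [H.eq_append]
  simp only [List.map_append, List.map_cons, List.sum_append, List.sum_cons, sum_map_run hf, he]
  omega

theorem des_eq (H : IsInsertion a j h c L A u v S) :
    ((A ++ (u ++ a :: v) :: S).map des).sum = (L.map des).sum + if c.1 then 1 else 0 := by
  refine H.sum_map_eq rfl ?_
  rw [des_append_cons H.mid_left H.mid_right, H.flags]
  simp

theorem valley_eq (H : IsInsertion a j h c L A u v S) :
    ((A ++ (u ++ a :: v) :: S).map valley).sum =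
      (L.map valley).sum + if c.1 ∧ c.2 then 1 else 0 := by
  refine H.sum_map_eq rfl ?_
  rw [valley_append_cons H.mid_left H.mid_right, H.flags]
  simp

theorem dd_eq (H : IsInsertion a j h c L A u v S) (ha : 0 < a) :
    ((A ++ (u ++ a :: v) :: S).map dd).sum =
      (L.map dd).sum + if c.1 ∧ ¬ c.2 then 1 else 0 := by
  refine H.sum_map_eq rfl ?_
  rw [dd_append_cons ha H.mid_left H.mid_right, H.flags]
  simp

end IsInsertion

/-! ### Eulerian and gamma polynomials as path sums -/

section

variable {R : Type*} [CommSemiring R] (p q : R)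

/-- The weight of a sequence of words by the statistics `(2-13)` and `(31-2)`. -/
def weight (L : List (List ℕ)) : R := p ^ resSeq L * q ^ lesSeq L

theorem weight_insert {a j h : ℕ} {c : Bool × Bool} {L A S : List (List ℕ)} {u v : List ℕ}
    (H : IsInsertion a j h c L A u v S) (ha : 0 < a) :
    weight p q (A ++ (u ++ a :: v) :: S) = p ^ (h - 1 - j) * q ^ j * weight p q L := by
  rw [weight, weight, H.lesSeq_eq ha, H.resSeq_eq ha]
  ring

theorem arrangementSum_des (t : R) {m a : ℕ} (ha : 0 < a) (h : ℕ) :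
    (arrangementSum m a h fun L => weight p q L * t ^ (L.map des).sum) =
      pathSum p q t (1 + t) m h := by
  induction m generalizing a h with
  | zero =>
    by_cases h0 : h = 0 <;>
      simp [arrangementSum, arrangements, pathSum, h0, weight, resSeq, lesSeq]
  | succ m ih =>
    rw [arrangementSum_succ_of_forall (p := p) (q := q) (g := fun c L =>
      (if c.1 then t else 1) * (weight p q L * t ^ (L.map des).sum))]
    · obtain _ | h := h
      · simp [pathSum, pqNat_zero]
      simp only [arrangementSum_mul, ih (Nat.succ_pos a), Fintype.sum_prod_type, Fintype.sum_bool,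
        Bool.toNat_true, Bool.toNat_false, pathSum, Nat.add_sub_cancel, Nat.add_zero, if_true,
        Bool.false_eq_true, if_false]
      ring
    · intro j _ c L A u v S H
      rw [weight_insert p q H ha, H.des_eq]
      split_ifs <;> ring

theorem arrangementSum_valley {m a : ℕ} (ha : 0 < a) (h k : ℕ) :
    (arrangementSum m a h fun L =>
      if (L.map valley).sum = k ∧ (L.map dd).sum = 0 then weight p q L else 0) =
      pathCoeff p q m h k := by
  induction m generalizing a h k with
  | zero =>
    by_cases h0 : h = 0 <;>
      simp [arrangementSum, arrangements, pathCoeff, h0, weight, resSeq, lesSeq, eq_comm]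
  | succ m ih =>
    -- With something before but nothing after it, the new letter is a double descent; with letters
    -- on both sides, a valley.
    rw [arrangementSum_succ_of_forall (p := p) (q := q) (g := fun c L => match c with
      | (true, false) => 0
      | (true, true) =>
        if (L.map valley).sum + 1 = k ∧ (L.map dd).sum = 0 then weight p q L else 0
      | _ => if (L.map valley).sum = k ∧ (L.map dd).sum = 0 then weight p q L else 0)]
    · obtain _ | h := h
      · cases k <;> simp [pathCoeff, pqNat_zero]
      obtain _ | k := k
      · simp [Fintype.sum_prod_type, ih, pathCoeff, arrangementSum_zero]
      · simp [Fintype.sum_prod_type, ih, pathCoeff, arrangementSum_zero, add_assoc]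
    · intro j _ c L A u v S H
      rw [weight_insert p q H ha, H.valley_eq, H.dd_eq ha]
      obtain ⟨_ | _, _ | _⟩ := c <;> simp

theorem sum_perm_eq_arrangementSum {n : ℕ} (hn : 1 ≤ n) (f : List (List ℕ) → R) :
    ∑ σ : Equiv.Perm (Fin n), f [word σ] = arrangementSum n 1 1 f := by
  rw [arrangementSum, ← map_word_eq_arrangements hn, Multiset.map_map]
  rfl

theorem lesSeq_singleton (w : List ℕ) : lesSeq [w] = les w := by
  simp [lesSeq, les_eq_lesRec]

theorem resSeq_singleton (w : List ℕ) : resSeq [w] = res w := by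
  simp [resSeq, lesSeq_singleton, res_eq_les_reverse]

theorem eulerian_eq_pathSum {n : ℕ} (hn : 1 ≤ n) (t : R) :
    eulerian n p q t = pathSum p q t (1 + t) n 1 := by
  rw [← arrangementSum_des p q t one_pos, ← sum_perm_eq_arrangementSum hn, eulerian]
  simp [weight, lesSeq_singleton, resSeq_singleton]

theorem gammaCoeff_eq_pathCoeff {n : ℕ} (hn : 1 ≤ n) (k : ℕ) :
    gammaCoeff n k p q = pathCoeff p q n 1 k := by
  rw [← arrangementSum_valley p q one_pos, ← sum_perm_eq_arrangementSum hn, gammaCoeff,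
    gammaPerms, Finset.sum_filter]
  simp [weight, lesSeq_singleton, resSeq_singleton]

end

/-! ### André words and blocks of words -/

/-- Every letter of `u` is at least some letter of `v`. -/
def Dominates (u v : List ℕ) : Prop := ∀ x ∈ u, ∃ y ∈ v, y ≤ x

/-- No subword formed by the letters at most some bound has a double descent. -/
def IsAndreWord (w : List ℕ) : Prop := ∀ k, dd (subword w k) = 0

theorem subword_eq_nil {w : List ℕ} {k : ℕ} : subword w k = [] ↔ ∀ x ∈ w, k < x := by
  simp [subword]

theorem isAndreWord_nil : IsAndreWord [] := fun _ => rfl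

/-- In the subword of letters at most `k`, `a` is a double descent iff a letter of `u` but none of
`v` survives. Taking for `k` a letter of `u` turns this into domination. -/
theorem isAndreWord_append_cons {a : ℕ} (ha : 0 < a) {u v : List ℕ} (hu : ∀ x ∈ u, a < x)
    (hv : ∀ x ∈ v, a < x) :
    IsAndreWord (u ++ a :: v) ↔ IsAndreWord u ∧ IsAndreWord v ∧ Dominates u v := by
  have key : ∀ k, a ≤ k → dd (subword (u ++ a :: v) k) = dd (subword u k) + dd (subword v k) +
      if subword u k ≠ [] ∧ subword v k = [] then 1 else 0 := by
    intro k hk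
    rw [← dd_append_cons ha (a := a)]
    · simp [subword, hk]
    · exact fun x hx => hu x (List.mem_filter.1 hx).1
    · exact fun x hx => hv x (List.mem_filter.1 hx).1
  have low : ∀ {w : List ℕ} {k}, (∀ x ∈ w, a < x) → k < a → subword w k = [] :=
    fun hw hk => subword_eq_nil.2 fun x hx => hk.trans (hw x hx)
  constructor
  · intro H
    refine ⟨fun k => ?_, fun k => ?_, fun x hx => ?_⟩
    · by_cases hk : a ≤ k
      · have := H k; rw [key k hk] at this; omega
      · rw [low hu (not_le.1 hk)]; rfl
    · by_cases hk : a ≤ k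
      · have := H k; rw [key k hk] at this; omega
      · rw [low hv (not_le.1 hk)]; rfl
    · by_contra! hcon
      have := H x
      rw [key x (hu x hx).le, if_pos] at this
      · omega
      · refine ⟨fun h => ?_, subword_eq_nil.2 hcon⟩
        exact absurd (subword_eq_nil.1 h x hx) (lt_irrefl x)
  · rintro ⟨h1, h2, h3⟩ k
    by_cases hk : a ≤ k
    · rw [key k hk, h1, h2, if_neg]
      rintro ⟨h4, h5⟩
      refine h4 (subword_eq_nil.2 fun x hx => ?_)
      obtain ⟨y, hy, hyx⟩ := h3 x hx
      exact (subword_eq_nil.1 h5 y hy).trans_le hyx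
    · have : subword (u ++ a :: v) k = [] := by
        have e1 := low hu (not_le.1 hk)
        have e2 := low hv (not_le.1 hk)
        unfold subword at e1 e2 ⊢
        rw [List.filter_append, e1, List.filter_cons_of_neg (by simpa using hk), e2]
        rfl
      rw [this]; rfl

/-- The words of a sequence satisfy the André condition and, for each `true` in the list of
blocks, belong to a block of two words the first of which dominates the second. -/
def IsAndreSeq : List Bool → List (List ℕ) → Prop
  | [], [] => True
  | false :: B, w :: L => IsAndreWord w ∧ IsAndreSeq B L
  | true :: B, w :: w' :: L => IsAndreWord w ∧ IsAndreWord w' ∧ Dominates w w' ∧ IsAndreSeq B L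
  | _, _ => False

/-- The number of words in a sequence with the given blocks. -/
def width (B : List Bool) : ℕ := B.length + B.count true

/-- The block of the word with index `j`, unless it is the first word of a block of two: whether
it is a block of two, the blocks before it (including one for the first word in a block of two),
and the blocks after it. -/
def locate : List Bool → ℕ → Option (Bool × List Bool × List Bool)
  | [], _ => none
  | false :: B, 0 => some (false, [], B)
  | true :: _, 0 => none
  | true :: B, 1 => some (true, [false], B)
  | false :: B, j + 1 => (locate B j).map fun x => (x.1, false :: x.2.1, x.2.2)
  | true :: B, j + 2 => (locate B j).map fun x => (x.1, true :: x.2.1, x.2.2)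

/-- The blocks that remain of a word after the removal of its least letter. -/
def innerBlocks : Bool × Bool → List Bool
  | (false, false) => []
  | (false, true) => [false]
  | (true, _) => [true]

theorem locate_spec {B : List Bool} {j : ℕ} {b : Bool} {B₁ B₂ : List Bool}
    (h : locate B j = some (b, B₁, B₂)) :
    B.count true = B₁.count true + B₂.count true + b.toNat ∧
      width B = width B₁ + width B₂ + 1 ∧ b.toNat ≤ j := by
  unfold width
  induction B, j using locate.induct generalizing b B₁ B₂ with
  | case1 => simp [locate] at h
  | case2 B =>
    simp only [locate, Option.some.injEq, Prod.mk.injEq] at h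
    obtain ⟨rfl, rfl, rfl⟩ := h
    simp; omega
  | case3 => simp [locate] at h
  | case4 B =>
    simp only [locate, Option.some.injEq, Prod.mk.injEq] at h
    obtain ⟨rfl, rfl, rfl⟩ := h
    simp; omega
  | case5 B j ih =>
    simp only [locate, Option.map_eq_some_iff, Prod.exists, Prod.mk.injEq] at h
    obtain ⟨b', C₁, C₂, h, rfl, rfl, rfl⟩ := h
    have := ih h
    simp at this ⊢; omega
  | case6 B j ih =>
    simp only [locate, Option.map_eq_some_iff, Prod.exists, Prod.mk.injEq] at h
    obtain ⟨b', C₁, C₂, h, rfl, rfl, rfl⟩ := h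
    have := ih h
    simp at this ⊢; omega

section

variable {a : ℕ} {u v : List ℕ} {A S : List (List ℕ)}

/-- Either the shapes do not match, or `a` lies in the first word of a pair whose second word has
only larger letters. -/
theorem not_isAndreSeq_of_locate_eq_none (hu : ∀ w ∈ S, ∀ x ∈ w, a < x) {B : List Bool}
    (h : locate B A.length = none) : ¬ IsAndreSeq B (A ++ (u ++ a :: v) :: S) := by
  generalize hj : A.length = j at h
  induction B, j using locate.induct generalizing A with
  | case1 => cases A <;> simp [IsAndreSeq]
  | case2 B => simp [locate] at h
  | case3 B =>
    rw [List.length_eq_zero_iff] at hj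
    subst hj
    cases S with
    | nil => simp [IsAndreSeq]
    | cons w S =>
      rintro ⟨-, -, h3, -⟩
      obtain ⟨y, hy, hya⟩ := h3 a (by simp)
      exact absurd (hu w (by simp) y hy) hya.not_gt
  | case4 B => simp [locate] at h
  | case5 B j ih =>
    obtain _ | ⟨w, A⟩ := A
    · simp at hj
    rw [locate, Option.map_eq_none_iff] at h
    exact fun H => ih (by simpa using hj) h H.2
  | case6 B j ih =>
    obtain _ | ⟨w, _ | ⟨w', A⟩⟩ := A
    · simp at hj
    · simp at hj
    rw [locate, Option.map_eq_none_iff] at h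
    exact fun H => ih (by simpa using hj) h H.2.2.2

theorem isAndreWord_append_cons_and (ha : 0 < a) (hu : ∀ x ∈ u, a < x) (hv : ∀ x ∈ v, a < x)
    (B : List Bool) : IsAndreWord (u ++ a :: v) ∧ IsAndreSeq B S ↔
      (u ≠ [] → v ≠ []) ∧
        IsAndreSeq (innerBlocks (!u.isEmpty, !v.isEmpty) ++ B) (run u ++ (run v ++ S)) := by
  rw [isAndreWord_append_cons ha hu hv]
  rcases u with _ | ⟨x, u⟩ <;> rcases v with _ | ⟨y, v⟩
  · simp [isAndreWord_nil, innerBlocks, Dominates]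
  · simp [isAndreWord_nil, innerBlocks, Dominates, run, IsAndreSeq]
  · simp only [ne_eq, reduceCtorEq, not_false_eq_true, not_true_eq_false, imp_false,
      false_and, iff_false]
    rintro ⟨⟨-, -, h⟩, -⟩
    simpa using h x
  · simp [innerBlocks, run, IsAndreSeq, and_assoc]

/-- If `a` lies in the second word of a pair, the first word dominates it through `a` alone. So the
first word becomes a free block, and the only new condition is the one between `u` and `v`. -/
theorem isAndreSeq_iff_of_locate_eq_some (ha : 0 < a) (hu : ∀ x ∈ u, a < x)
    (hv : ∀ x ∈ v, a < x) (hA : ∀ w ∈ A, ∀ x ∈ w, a < x) {B : List Bool} {b : Bool}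
    {B₁ B₂ : List Bool} (h : locate B A.length = some (b, B₁, B₂)) :
    IsAndreSeq B (A ++ (u ++ a :: v) :: S) ↔ (u ≠ [] → v ≠ []) ∧
      IsAndreSeq (B₁ ++ (innerBlocks (!u.isEmpty, !v.isEmpty) ++ B₂))
        (A ++ (run u ++ (run v ++ S))) := by
  generalize hj : A.length = j at h
  induction B, j using locate.induct generalizing A b B₁ B₂ with
  | case1 => simp [locate] at h
  | case2 B =>
    rw [List.length_eq_zero_iff] at hj
    subst hj
    simp only [locate, Option.some.injEq, Prod.mk.injEq] at h
    obtain ⟨rfl, rfl, rfl⟩ := h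
    exact isAndreWord_append_cons_and ha hu hv B
  | case3 B => simp [locate] at h
  | case4 B =>
    obtain _ | ⟨w, _ | ⟨w', A⟩⟩ := A
    · simp at hj
    · simp only [locate, Option.some.injEq, Prod.mk.injEq] at h
      obtain ⟨rfl, rfl, rfl⟩ := h
      have hd : Dominates w (u ++ a :: v) := fun x hx => ⟨a, by simp, (hA w (by simp) x hx).le⟩
      have := isAndreWord_append_cons_and ha hu hv (S := S) B
      simp only [List.cons_append, List.nil_append, IsAndreSeq, hd, true_and, this]
      tauto
    · simp at hj
  | case5 B j ih =>
    obtain _ | ⟨w, A⟩ := A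
    · simp at hj
    simp only [locate, Option.map_eq_some_iff, Prod.exists, Prod.mk.injEq] at h
    obtain ⟨b', C₁, C₂, h, rfl, rfl, rfl⟩ := h
    have := ih (A := A) (fun w hw => hA w (by simp [hw])) (by simpa using hj) h
    simp only [List.cons_append, IsAndreSeq, this]
    tauto
  | case6 B j ih =>
    obtain _ | ⟨w, _ | ⟨w', A⟩⟩ := A
    · simp at hj
    · simp at hj
    simp only [locate, Option.map_eq_some_iff, Prod.exists, Prod.mk.injEq] at h
    obtain ⟨b', C₁, C₂, h, rfl, rfl, rfl⟩ := h
    have := ih (A := A) (fun w hw => hA w (by simp [hw])) (by simpa using hj) h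
    simp only [List.cons_append, IsAndreSeq, this]
    tauto

end

namespace IsInsertion

variable {a j : ℕ} {c : Bool × Bool} {L A S : List (List ℕ)} {u v : List ℕ} {B : List Bool}

theorem not_isAndreSeq {h : ℕ} (H : IsInsertion a j h c L A u v S) (hB : locate B j = none) :
    ¬ IsAndreSeq B (A ++ (u ++ a :: v) :: S) :=
  not_isAndreSeq_of_locate_eq_none (fun w hw => (H.right w hw).2) (H.length_left ▸ hB)

theorem isAndreSeq_iff {h : ℕ} (H : IsInsertion a j h c L A u v S) (ha : 0 < a) {b : Bool}
    {B₁ B₂ : List Bool} (hB : locate B j = some (b, B₁, B₂)) :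
    IsAndreSeq B (A ++ (u ++ a :: v) :: S) ↔
      c ≠ (true, false) ∧ IsAndreSeq (B₁ ++ (innerBlocks c ++ B₂)) L := by
  rw [isAndreSeq_iff_of_locate_eq_some ha H.mid_left H.mid_right (fun w hw => (H.left w hw).2)
    (H.length_left ▸ hB), ← H.flags, ← H.eq_append, H.flags]
  simp

end IsInsertion

theorem count_true_innerBlocks {B₁ B₂ : List Bool} {c : Bool × Bool} :
    (B₁ ++ (innerBlocks c ++ B₂)).count true = B₁.count true + B₂.count true + c.1.toNat := by
  obtain ⟨_ | _, _ | _⟩ := c <;> simp [innerBlocks] <;> omega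

theorem width_innerBlocks {B₁ B₂ : List Bool} {c : Bool × Bool} (hc : c ≠ (true, false)) :
    width (B₁ ++ (innerBlocks c ++ B₂)) = width B₁ + width B₂ + c.1.toNat + c.2.toNat := by
  obtain ⟨_ | _, _ | _⟩ := c <;> simp [innerBlocks, width] at hc ⊢ <;> omega

/-- Deleting `a` trades a descent for a new pair, and dissolves an old pair only if `a` lies in its
second word, where `j ≥ 1` pays for it. -/
theorem des_add_count_le_lesSeq {m a : ℕ} (ha : 0 < a) {B : List Bool} {L : List (List ℕ)}
    (hL : L ∈ arrangements m a (width B)) (hB : IsAndreSeq B L) :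
    (L.map des).sum + B.count true ≤ lesSeq L := by
  induction m generalizing a B L with
  | zero =>
    by_cases h0 : width B = 0
    · simp only [arrangements, h0, if_true, Multiset.mem_singleton] at hL
      simp only [width, Nat.add_eq_zero_iff] at h0
      simp [hL, h0.2]
    · simp [arrangements, h0] at hL
  | succ m ih =>
    obtain ⟨j, hj, c, C, hC, rfl⟩ := mem_arrangements_succ.1 hL
    obtain ⟨A, u, v, S, H⟩ := exists_isInsertion_of_mem hj c hC
    rw [H.insert_eq] at hB ⊢
    rcases hl : locate B j with _ | ⟨b, B₁, B₂⟩
    · exact absurd hB (H.not_isAndreSeq hl)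
    · obtain ⟨hc, hB'⟩ := (H.isAndreSeq_iff ha hl).1 hB
      obtain ⟨h1, h2, h3⟩ := locate_spec hl
      have h4 := width_innerBlocks (B₁ := B₁) (B₂ := B₂) hc
      have := ih (Nat.succ_pos a) (B := B₁ ++ (innerBlocks c ++ B₂))
        (by rwa [h4, show width B₁ + width B₂ = width B - 1 by omega]) hB'
      rw [count_true_innerBlocks] at this
      rw [H.lesSeq_eq ha, H.des_eq]
      cases h : c.1 <;> simp [h] at this ⊢ <;> omega

/-! ### Block weights and the André polynomials -/

section

variable {R : Type*} [CommSemiring R] (p q : R)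

theorem pqNat_add (i j : ℕ) : pqNat p q (i + j) = pqNat p q i * p ^ j + q ^ i * pqNat p q j := by
  rw [pqNat, Finset.sum_range_add, pqNat, pqNat, Finset.sum_mul, Finset.mul_sum]
  congr 1
  · refine Finset.sum_congr rfl fun x hx => ?_
    rw [Finset.mem_range] at hx
    rw [show i + j - 1 - x = i - 1 - x + j by omega, pow_add]
    ring
  · refine Finset.sum_congr rfl fun x hx => ?_
    rw [Finset.mem_range] at hx
    rw [show i + j - 1 - (i + x) = j - 1 - x by omega, pow_add]
    ring

/-- The weight of the words in which the next letter may be inserted, where a block of two words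
contributes `p + q`. -/
def blockWeight (B : List Bool) (j : ℕ) : R :=
  match locate B j with
  | none => 0
  | some (b, _, _) => q ^ (j - b.toNat) * (p + q) ^ b.toNat

theorem blockWeight_cons_false (B : List Bool) (j : ℕ) :
    blockWeight p q (false :: B) (j + 1) = q * blockWeight p q B j := by
  simp only [blockWeight, locate]
  rcases h : locate B j with _ | ⟨b, B₁, B₂⟩
  · simp
  · have := (locate_spec h).2.2
    simp only [Option.map_some]
    rw [show j + 1 - b.toNat = j - b.toNat + 1 by omega]
    ring

theorem blockWeight_cons_true (B : List Bool) (j : ℕ) :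
    blockWeight p q (true :: B) (j + 2) = q ^ 2 * blockWeight p q B j := by
  simp only [blockWeight, locate]
  rcases h : locate B j with _ | ⟨b, B₁, B₂⟩
  · simp
  · have := (locate_spec h).2.2
    simp only [Option.map_some]
    rw [show j + 2 - b.toNat = j - b.toNat + 2 by omega]
    ring

/-- A pair ending at index `j` contributes nothing at `j - 1`, and its factor `q ^ (j - 1) * (p +
q)` at `j` makes up for both positions. So the sum depends only on the width. -/
theorem sum_blockWeight (B : List Bool) :
    ∑ j ∈ Finset.range (width B), p ^ (width B - 1 - j) * blockWeight p q B j =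
      pqNat p q (width B) := by
  induction B with
  | nil => simp [width, pqNat]
  | cons b B ih =>
    cases b with
    | false =>
      have h : width (false :: B) = width B + 1 := by simp [width]; omega
      rw [h, Finset.sum_range_succ', add_comm (width B) 1, pqNat_add, ← ih, Finset.mul_sum,
        add_comm]
      congr 1
      · simp [blockWeight, locate, pqNat]
      · refine Finset.sum_congr rfl fun j _ => ?_
        rw [blockWeight_cons_false, show 1 + width B - 1 - (j + 1) = width B - 1 - j by omega]
        ring
    | true =>
      have h : width (true :: B) = width B + 1 + 1 := by simp [width]; omega
      rw [h, Finset.sum_range_succ', Finset.sum_range_succ', add_assoc (width B) 1 1,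
        add_comm (width B) (1 + 1), pqNat_add, ← ih, Finset.mul_sum, add_assoc, add_comm]
      congr 1
      · simp [blockWeight, locate, pqNat, Finset.sum_range_succ]
        ring
      · refine Finset.sum_congr rfl fun j _ => ?_
        rw [blockWeight_cons_true, show 1 + 1 + width B - 1 - (j + 1 + 1) = width B - 1 - j by omega]
        ring

open Classical in
/-- The summand of an arrangement in the polynomial `andreSum`. -/
noncomputable def andreTerm (B : List Bool) (k : ℕ) (L : List (List ℕ)) : R :=
  if IsAndreSeq B L ∧ (L.map des).sum = k then
    p ^ resSeq L * q ^ (lesSeq L - k - B.count true) else 0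

/-- The polynomial of the arrangements which satisfy the André condition for the blocks `B`. -/
noncomputable def andreSum (m a : ℕ) (B : List Bool) (k : ℕ) : R :=
  arrangementSum m a (width B) (andreTerm p q B k)

section

variable {p q} {m a j : ℕ} {B : List Bool}

theorem arrangementSum_andreTerm_of_locate (ha : 0 < a) (hj : j < width B)
    {c : Bool × Bool} (hc : c ≠ (true, false))
    {b : Bool} {B₁ B₂ : List Bool} (hB : locate B j = some (b, B₁, B₂)) (k : ℕ) :
    (arrangementSum m (a + 1) (width B - 1 + c.1.toNat + c.2.toNat) fun L =>
      andreTerm p q B (k + c.1.toNat) (insertMin a j c L)) =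
    p ^ (width B - 1 - j) * q ^ (j - b.toNat) *
      andreSum p q m (a + 1) (B₁ ++ (innerBlocks c ++ B₂)) k := by
  obtain ⟨h1, h2, h3⟩ := locate_spec hB
  have h4 := width_innerBlocks (B₁ := B₁) (B₂ := B₂) hc
  rw [show width B₁ + width B₂ = width B - 1 by omega] at h4
  rw [andreSum, h4, ← arrangementSum_mul]
  refine arrangementSum_congr fun L hL => ?_
  obtain ⟨A, u, v, S, H⟩ := exists_isInsertion_of_mem hj c hL
  rw [H.insert_eq, andreTerm, andreTerm, H.isAndreSeq_iff ha hB, H.des_eq]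
  have h5 : ((L.map des).sum + if c.1 then 1 else 0) = k + c.1.toNat ↔
      (L.map des).sum = k := by
    cases c.1 <;> simp
  by_cases h : IsAndreSeq (B₁ ++ (innerBlocks c ++ B₂)) L ∧ (L.map des).sum = k
  · rw [if_pos ⟨⟨hc, h.1⟩, h5.2 h.2⟩, if_pos h, H.lesSeq_eq ha, H.resSeq_eq ha]
    -- This bound keeps the natural subtractions in the exponent of `q` from truncating.
    have h6 := des_add_count_le_lesSeq (Nat.succ_pos a) (h4 ▸ hL) h.1
    rw [h.2] at h6
    rw [count_true_innerBlocks] at h6 ⊢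
    rw [show lesSeq L + j - (k + c.1.toNat) - B.count true = j - b.toNat +
      (lesSeq L - k - (B₁.count true + B₂.count true + c.1.toNat)) by omega]
    ring
  · rw [if_neg h, if_neg fun h' => h ⟨h'.1.2, h5.1 h'.2⟩, mul_zero]

theorem arrangementSum_andreTerm_of_des (ha : 0 < a) (hj : j < width B) {b : Bool}
    {B₁ B₂ : List Bool} (hB : locate B j = some (b, B₁, B₂)) {c : Bool × Bool} {k : ℕ}
    (hc : c = (true, false) ∨ c.1 = true ∧ k = 0) :
    (arrangementSum m (a + 1) (width B - 1 + c.1.toNat + c.2.toNat) fun L =>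
      andreTerm p q B k (insertMin a j c L)) = 0 := by
  refine (arrangementSum_congr fun L hL => ?_).trans (arrangementSum_zero ..)
  obtain ⟨A, u, v, S, H⟩ := exists_isInsertion_of_mem hj c hL
  rw [H.insert_eq, andreTerm, H.isAndreSeq_iff ha hB, H.des_eq, if_neg]
  rintro ⟨⟨h1, -⟩, h2⟩
  rcases hc with hc | ⟨hc, rfl⟩
  · exact h1 hc
  · simp [hc] at h2

theorem arrangementSum_andreTerm_of_none (hj : j < width B) (hB : locate B j = none)
    (c : Bool × Bool) (k : ℕ) :
    (arrangementSum m (a + 1) (width B - 1 + c.1.toNat + c.2.toNat) fun L =>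
      andreTerm p q B k (insertMin a j c L)) = 0 := by
  refine (arrangementSum_congr fun L hL => ?_).trans (arrangementSum_zero ..)
  obtain ⟨A, u, v, S, H⟩ := exists_isInsertion_of_mem hj c hL
  rw [H.insert_eq, andreTerm, if_neg fun h => H.not_isAndreSeq hB h.1]

end

/-- The general `B` is needed for the induction, though the right side sees only its width. A
descent lowers `k` by one and adds a pair, which keeps `B.count true + k`; a dissolved pair releases
the factor `p + q` used in `blockWeight`. -/
theorem pow_mul_andreSum {m a : ℕ} (ha : 0 < a) (B : List Bool) (k : ℕ) :
    (p + q) ^ (B.count true + k) * andreSum p q m a B k = pathCoeff p q m (width B) k := by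
  induction m generalizing a B k with
  | zero =>
    cases B with
    | nil =>
      by_cases hk : 0 = k
      · simp [andreSum, andreTerm, arrangementSum, arrangements, pathCoeff, width, IsAndreSeq,
          resSeq, lesSeq, ← hk]
      · simp [andreSum, andreTerm, arrangementSum, arrangements, pathCoeff, width, hk,
          Ne.symm hk]
    | cons b B =>
      simp [andreSum, arrangementSum, arrangements, pathCoeff, width]
  | succ m ih =>
    rw [andreSum, arrangementSum_succ, Finset.mul_sum]
    -- It suffices to treat each position `j` separately with a common factor `K`; `sum_blockWeight`
    -- does the rest.
    have hsum : ∀ K : R, (∀ j < width B, (p + q) ^ (B.count true + k) * ∑ c : Bool × Bool,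
        (arrangementSum m (a + 1) (width B - 1 + c.1.toNat + c.2.toNat) fun L =>
          andreTerm p q B k (insertMin a j c L)) =
        p ^ (width B - 1 - j) * blockWeight p q B j * K) →
        ∑ j ∈ Finset.range (width B), (p + q) ^ (B.count true + k) * ∑ c : Bool × Bool,
        (arrangementSum m (a + 1) (width B - 1 + c.1.toNat + c.2.toNat) fun L =>
          andreTerm p q B k (insertMin a j c L)) = pqNat p q (width B) * K := by
      intro K hK
      rw [← sum_blockWeight, Finset.sum_mul]
      exact Finset.sum_congr rfl fun j hj => hK j (Finset.mem_range.1 hj)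
    obtain _ | k := k
    · rw [pathCoeff]
      refine hsum _ fun j hj => ?_
      rcases hl : locate B j with _ | ⟨b, B₁, B₂⟩
      · rw [Finset.sum_eq_zero fun c _ => arrangementSum_andreTerm_of_none hj hl c _]
        simp [blockWeight, hl]
      · obtain ⟨h1, h2, h3⟩ := locate_spec hl
        have e1 := arrangementSum_andreTerm_of_locate (p := p) (q := q) (m := m) ha hj
          (c := (false, false)) (by simp) hl 0
        have e2 := arrangementSum_andreTerm_of_locate (p := p) (q := q) (m := m) ha hj
          (c := (false, true)) (by simp) hl 0
        have e3 := arrangementSum_andreTerm_of_des (p := p) (q := q) (m := m) ha hj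
          hl (c := (true, false)) (k := 0) (by simp)
        have e4 := arrangementSum_andreTerm_of_des (p := p) (q := q) (m := m) ha hj
          hl (c := (true, true)) (k := 0) (by simp)
        have i1 := ih (Nat.succ_pos a) (B₁ ++ (innerBlocks (false, false) ++ B₂)) 0
        have i2 := ih (Nat.succ_pos a) (B₁ ++ (innerBlocks (false, true) ++ B₂)) 0
        rw [width_innerBlocks (by simp), count_true_innerBlocks] at i1 i2
        simp only [Bool.toNat_false, Bool.toNat_true, Nat.add_zero] at e1 e2 e3 e4 i1 i2
        rw [show width B₁ + width B₂ = width B - 1 by omega] at i1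
        rw [show width B₁ + width B₂ + 1 = width B by omega] at i2
        simp only [Fintype.sum_prod_type, Fintype.sum_bool, Bool.toNat_false, Bool.toNat_true,
          Nat.add_zero, e1, e2, e3, e4, blockWeight, hl, ← i1, ← i2, h1]
        ring
    · rw [pathCoeff]
      refine hsum _ fun j hj => ?_
      rcases hl : locate B j with _ | ⟨b, B₁, B₂⟩
      · rw [Finset.sum_eq_zero fun c _ => arrangementSum_andreTerm_of_none hj hl c _]
        simp [blockWeight, hl]
      · obtain ⟨h1, h2, h3⟩ := locate_spec hl
        have e1 := arrangementSum_andreTerm_of_locate (p := p) (q := q) (m := m) ha hj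
          (c := (false, false)) (by simp) hl (k + 1)
        have e2 := arrangementSum_andreTerm_of_locate (p := p) (q := q) (m := m) ha hj
          (c := (false, true)) (by simp) hl (k + 1)
        have e3 := arrangementSum_andreTerm_of_des (p := p) (q := q) (m := m) ha hj
          hl (c := (true, false)) (k := k + 1) (by simp)
        have e4 := arrangementSum_andreTerm_of_locate (p := p) (q := q) (m := m) ha hj
          (c := (true, true)) (by simp) hl k
        have i1 := ih (Nat.succ_pos a) (B₁ ++ (innerBlocks (false, false) ++ B₂)) (k + 1)
        have i2 := ih (Nat.succ_pos a) (B₁ ++ (innerBlocks (false, true) ++ B₂)) (k + 1)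
        have i4 := ih (Nat.succ_pos a) (B₁ ++ (innerBlocks (true, true) ++ B₂)) k
        rw [width_innerBlocks (by simp), count_true_innerBlocks] at i1 i2 i4
        simp only [Bool.toNat_false, Bool.toNat_true, Nat.add_zero] at e1 e2 e3 e4 i1 i2 i4
        rw [show width B₁ + width B₂ = width B - 1 by omega] at i1
        rw [show width B₁ + width B₂ + 1 = width B by omega] at i2
        rw [show width B₁ + width B₂ + 1 + 1 = width B + 1 by omega] at i4
        simp only [Fintype.sum_prod_type, Fintype.sum_bool, Bool.toNat_false, Bool.toNat_true,
          Nat.add_zero, e1, e2, e3, e4, blockWeight, hl, ← i1, ← i2, ← i4, h1]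
        ring

/-! ### Return to permutations -/

theorem isAndre_iff_isAndreWord {n : ℕ} (σ : Equiv.Perm (Fin n)) :
    IsAndre σ ↔ IsAndreWord (word σ) := by
  have hmem : ∀ x ∈ word σ, 1 ≤ x ∧ x ≤ n := by
    intro x hx
    have := (word_perm_range' σ).mem_iff.1 hx
    rw [List.mem_range'_1] at this
    omega
  refine ⟨fun H k => ?_, fun H k _ => H k⟩
  rcases Nat.eq_zero_or_pos k with rfl | hk
  · rw [subword_eq_nil.2 fun x hx => (hmem x hx).1]; rfl
  · have hle : subword (word σ) k = subword (word σ) (min k n) := by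
      refine List.filter_congr fun x hx => ?_
      simp [(hmem x hx).2]
    rcases Nat.eq_zero_or_pos n with rfl | hn
    · rw [hle, subword_eq_nil.2 fun x hx => by have := hmem x hx; omega]; rfl
    · rw [hle]
      exact H _ (Finset.mem_Icc.2 ⟨by omega, by omega⟩)

theorem isAndreSeq_word {n : ℕ} (σ : Equiv.Perm (Fin n)) :
    IsAndreSeq [false] [word σ] ↔ IsAndre σ := by
  simp [IsAndreSeq, isAndre_iff_isAndreWord]

theorem andreCoeff_eq_andreSum {n : ℕ} (hn : 1 ≤ n) (k : ℕ) :
    andreCoeff n k p q = andreSum p q n 1 [false] k := by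
  rw [andreSum, show width [false] = 1 from rfl, ← sum_perm_eq_arrangementSum hn, andreCoeff,
    andrePerms, Finset.sum_filter]
  refine Finset.sum_congr rfl fun σ _ => ?_
  rw [andreTerm, isAndreSeq_word]
  simp [lesSeq_singleton, resSeq_singleton]

theorem gammaCoeff_eq_pow_mul_andreCoeff {n : ℕ} (hn : 1 ≤ n) (k : ℕ) :
    gammaCoeff n k p q = (p + q) ^ k * andreCoeff n k p q := by
  rw [gammaCoeff_eq_pathCoeff p q hn, andreCoeff_eq_andreSum p q hn]
  simpa [width] using (pow_mul_andreSum p q (m := n) one_pos [false] k).symm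

end

theorem le_les_of_mem_andrePerms {n : ℕ} (hn : 1 ≤ n) {k : ℕ} {σ : Equiv.Perm (Fin n)}
    (hσ : σ ∈ andrePerms n k) : k ≤ les (word σ) := by
  obtain ⟨-, h1, rfl⟩ := Finset.mem_filter.1 hσ
  have hmem : [word σ] ∈ arrangements n 1 (width [false]) := by
    rw [show width [false] = 1 from rfl, ← map_word_eq_arrangements hn]
    exact Multiset.mem_map.2 ⟨σ, Finset.mem_univ σ, rfl⟩
  have := des_add_count_le_lesSeq one_pos hmem ((isAndreSeq_word σ).2 h1)
  simpa [lesSeq_singleton] using this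

end PQEulerian

theorem mainTheorem1 (n : ℕ) (hn : 1 ≤ n) :
    (∀ k : ℕ, ∀ σ ∈ PQEulerian.andrePerms n k, k ≤ PQEulerian.les (PQEulerian.word σ)) ∧
    ∀ {R : Type*} [CommSemiring R] (p q t : R),
      PQEulerian.eulerian n p q t =
        ∑ k ∈ Finset.range ((n - 1) / 2 + 1),
          PQEulerian.gammaCoeff n k p q * t ^ k * (1 + t) ^ (n - 1 - 2 * k) ∧
      PQEulerian.eulerian n p q t =
        ∑ k ∈ Finset.range ((n - 1) / 2 + 1),
          (p + q) ^ k * PQEulerian.andreCoeff n k p q * t ^ k * (1 + t) ^ (n - 1 - 2 * k) ∧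
      ∀ k : ℕ, k ≤ (n - 1) / 2 →
        PQEulerian.gammaCoeff n k p q = (p + q) ^ k * PQEulerian.andreCoeff n k p q := by
  refine ⟨fun k σ hσ => PQEulerian.le_les_of_mem_andrePerms hn hσ, fun {R} _ p q t => ?_⟩
  have h : PQEulerian.eulerian n p q t = ∑ k ∈ Finset.range ((n - 1) / 2 + 1),
      PQEulerian.gammaCoeff n k p q * t ^ k * (1 + t) ^ (n - 1 - 2 * k) := by
    rw [PQEulerian.eulerian_eq_pathSum p q hn, PQEulerian.pathSum_eq_sum_range p q t (1 + t) hn]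
    simp only [PQEulerian.gammaCoeff_eq_pathCoeff p q hn]
  refine ⟨h, ?_, fun k _ => PQEulerian.gammaCoeff_eq_pow_mul_andreCoeff p q hn k⟩
  rw [h]
  simp only [PQEulerian.gammaCoeff_eq_pow_mul_andreCoeff p q hn]
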